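/- **Setting.** For a vector $x\in\mathbb R^D$ let $\|x\|_p$ be its $\ell_p$ norm, and for a $D\times D$ matrix $A$ let $\|A\|_{p\to q}=\max_{\|x\|_p\le 1}\|Ax\|_q$. Fix $p,q\in[1,\infty]$ with $\frac1p+\frac1q=1$, and constants $H_0\ge 0$, $H_1>0$, $\tau\in(0,1]$, $\mu>0$. We say that $f:\mathbb R^D\to\mathbb R$ satisfies the assumptions if it is twice differentiable and non-negative, $f^*:=\inf_\theta f(\theta)=0$, and for all $\theta$ - (NS) $\|\nabla^2 f(\theta)\|_{p\to q}\le H_0+H_1 f(\theta)$, - (NL) $\|\nabla f(\theta)\|_q\ge \mu\,[f(\theta)-f^*]^{\tau}$. Let $0\le\beta_1\le\beta_2<1$. Deterministic diagonal Adam without bias correction, with constant step-size $\eta$ (and $\delta=0$ added to the denominator), started at $\theta_1$, is given for $t\ge1$ and every coordinate $i$, with $g_t=\nabla f(\theta_t)$, by $$m_{t,i}=\beta_1 m_{t-1,i}+(1-\beta_1)g_{t,i},\qquad v_{t,i}=\beta_2v_{t-1,i}+(1-\beta_2)g_{t,i}^2,\qquad \theta_{t+1,i}=\theta_{t,i}-\eta\,\frac{m_{t,i}}{\sqrt{v_{t,i}}},$$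 where $v_0=0$, $m_0=g_1$ (or alternatively $m_0=0$), and $0/0:=0$. **Theorem.** Let $F,K$ be real numbers. In what follows $f$ ranges over all functions on $\mathbb R^D$ that satisfy the assumptions, for all dimensions $D$ with $D^{1/p}\le K$, and $\theta_1$ over all points with $f(\theta_1)\le F$. (For $p=\infty$, $q=1$, one has $D^{1/p}=1$, and with $K=1$ the constants below do not depend on the dimension.) 1. There is $\bar\eta>0$, depending only on $p,q,H_1,\tau,\mu,\beta_1,\beta_2,F,K$, such that for each $\eta\in(0,\bar\eta]$ there is a constant $C$, depending only on the same quantities and $\eta$, with the following property. For every $H_0\ge0$, all such $f,\theta_1$, and every $\epsilon>\frac{H_0}{H_1}$, Adam with the constant step-size $\eta$ satisfies $f(\theta_{T+1})\le\epsilon$ for some $T\le C\,(1+\max\{0,\ln\frac1\epsilon\})$. 2. For every $H_0\ge0$ there is $\bar c>0$, depending only on $p,q,H_0,H_1,\tau,\mu,\beta_1,\beta_2,F,K$, such that for each $c\in(0,\bar c]$ there is a constant $C$, depending only on the same quantities and $c$, with the following property. For all such $f,\theta_1$ and every $0<\epsilon\le\frac{H_0}{H_1}$, Adam with the constant step-size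 $\eta=c\,\epsilon^{2\tau}$ satisfies $f(\theta_{T+1})\le\epsilon$ for some $T$ with - $T\le C/\epsilon^{2\tau}$ if $\tau\le\frac12$, - $T\le C/\epsilon^{4\tau-1}$ if $\tau>\frac12$. -/

import Mathlib

noncomputable section

/-- The `ℓᵖ` norm of a vector of `ℝᴰ`, for `1 ≤ p ≤ ∞`. -/
def lpNorm {D : ℕ} (p : ENNReal) [Fact (1 ≤ p)] (x : EuclideanSpace ℝ (Fin D)) : ℝ :=
  ‖WithLp.toLp p (WithLp.ofLp x)‖

/-- The Hessian matrix: entry `(i, j)` is the `j`-th partial derivative of the `i`-th coordinate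
of the gradient. -/
def hessian {D : ℕ} (f : EuclideanSpace ℝ (Fin D) → ℝ) (θ : EuclideanSpace ℝ (Fin D)) :
    Matrix (Fin D) (Fin D) ℝ :=
  Matrix.of fun i j => fderiv ℝ (gradient f) θ (EuclideanSpace.single j 1) i

/-- The induced norm `‖A‖_{p → q} = max {‖A x‖_q : ‖x‖_p ≤ 1}` of a matrix, as the operator norm
of `x ↦ A x` from `ℝᴰ` with the `ℓᵖ` norm to `ℝᴰ` with the `ℓ^q` norm. -/
def inducedNorm {D : ℕ} (p q : ENNReal) [Fact (1 ≤ p)] [Fact (1 ≤ q)]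
    (A : Matrix (Fin D) (Fin D) ℝ) : ℝ :=
  ‖LinearMap.toContinuousLinearMap (Matrix.toLpLin p q A)‖

/-- `f` is twice differentiable (no continuity of the second derivative is asked for). -/
def TwiceDifferentiable {D : ℕ} (f : EuclideanSpace ℝ (Fin D) → ℝ) : Prop :=
  Differentiable ℝ f ∧ Differentiable ℝ (gradient f)

/-- `(H₀, H₁)` non-uniform smoothness with respect to the exponents `p, q`. -/
def NonUniformSmooth {D : ℕ} (p q : ENNReal) [Fact (1 ≤ p)] [Fact (1 ≤ q)] (H₀ H₁ : ℝ)
    (f : EuclideanSpace ℝ (Fin D) → ℝ) : Prop :=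
  ∀ θ, inducedNorm p q (hessian f θ) ≤ H₀ + H₁ * f θ

/-- The infimum `f*` of `f` (used for `f ≥ 0` only, so that it is a true infimum). -/
def fStar {D : ℕ} (f : EuclideanSpace ℝ (Fin D) → ℝ) : ℝ := ⨅ θ, f θ

/-- The non-uniform Łojasiewicz condition with exponent `τ` and factor `μ(θ) > 0`. -/
def NonUniformLojasiewicz {D : ℕ} (q : ENNReal) [Fact (1 ≤ q)] (τ : ℝ)
    (μ : EuclideanSpace ℝ (Fin D) → ℝ) (f : EuclideanSpace ℝ (Fin D) → ℝ) : Prop :=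
  ∀ θ, 0 < μ θ ∧ μ θ * (f θ - fStar f) ^ τ ≤ lpNorm q (gradient f θ)

/-- The standing assumptions on the objective: twice differentiable and non-negative,
`(H₀, H₁)` non-uniformly smooth, infimum `0`, Łojasiewicz with a uniform factor `μ`. -/
structure ObjectiveAssumptions {D : ℕ} (p q : ENNReal) [Fact (1 ≤ p)] [Fact (1 ≤ q)]
    (H₀ H₁ τ μ : ℝ) (f : EuclideanSpace ℝ (Fin D) → ℝ) : Prop where
  twiceDiff : TwiceDifferentiable f
  nonneg : ∀ θ, 0 ≤ f θ
  smooth : NonUniformSmooth p q H₀ H₁ f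
  inf_eq_zero : fStar f = 0
  lojasiewicz : NonUniformLojasiewicz q τ (fun _ => μ) f

/-- The state of Adam: position, momentum and second-moment vector. -/
structure AdamState (D : ℕ) where
  pos : EuclideanSpace ℝ (Fin D)
  mom : EuclideanSpace ℝ (Fin D)
  sec : EuclideanSpace ℝ (Fin D)

/-- One step of deterministic diagonal Adam without bias correction, with step-size `η`:
`(θ_t, m_{t-1}, v_{t-1}) ↦ (θ_{t+1}, m_t, v_t)`. Division by zero gives zero, so that a
coordinate in which every gradient so far vanishes is left alone if `δ = 0`. -/
def adamStep {D : ℕ} (f : EuclideanSpace ℝ (Fin D) → ℝ) (β₁ β₂ δ η : ℝ) (s : AdamState D) :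
    AdamState D :=
  let g := gradient f s.pos
  let m : EuclideanSpace ℝ (Fin D) := WithLp.toLp 2 fun i => β₁ * s.mom i + (1 - β₁) * g i
  let v : EuclideanSpace ℝ (Fin D) := WithLp.toLp 2 fun i => β₂ * s.sec i + (1 - β₂) * g i ^ 2
  { pos := WithLp.toLp 2 fun i => s.pos i - η * (m i / (√(v i) + δ))
    mom := m
    sec := v }

/-- The state `(θ_{T+1}, m_T, v_T)` of Adam after `T` iterations with constant step-size `η`,
started at `θ₁` with momentum `m₀` and second moment `v₀ = 0`. -/
def adam {D : ℕ} (f : EuclideanSpace ℝ (Fin D) → ℝ) (β₁ β₂ δ η : ℝ)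
    (θ₁ m₀ : EuclideanSpace ℝ (Fin D)) (T : ℕ) : AdamState D :=
  (adamStep f β₁ β₂ δ η)^[T] ⟨θ₁, m₀, 0⟩

end

/-!
Write `g = ∇f(θ)`, `h = H₀ / H₁` and `Φ = f + h`.

*Reduction to one pair of norms.* Since `1 / p + 1 / q = 1`, passing from `ℓ^∞` to `ℓᵖ` and from
`ℓ^q` to `ℓ¹` costs the factor `D ^ (1 / p) ≤ K` each time. The smoothness assumption thus gives
`‖∇²f‖_{∞ → 1} ≤ L Φ` with `L = max(K, 1)² H₁`, which does not involve `H₀`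
(`ObjectiveAssumptions.relativelySmooth`), and the Łojasiewicz condition gives `‖g‖₁ ≥ μ f ^ τ`.

*Calculus.* Along a segment of `ℓ^∞` length `r`, `Φ` satisfies `Φ'' ≤ L r² Φ`. Being nonnegative on
the whole line, it then satisfies `|Φ'| ≤ √L r Φ`, so it grows at most by the factor `exp (√L r)`.
Consequently the `ℓ¹` change of `g` is `O(r Φ)` and the first-order Taylor remainder is `O(r² Φ)`.

*Adam.* Because `β₁ ≤ β₂`, every coordinate satisfies `|m| ≤ M √v` with `M = 1 / √(1 - β₂)`, so a
step has `ℓ^∞` length at most `r = η M`. For small `η` the gradient changes slowly compared with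
the geometric forgetting of the averages, and an induction over the steps (`AveragesTrack.step`)
shows that `m` is `α g` and that `√v` is at most `A |g|`, both up to `O(η Φ)` in `ℓ¹`, where
`1 - β₁ ≤ α ≤ 1`. As `g² / (A |g| + x) ≥ |g| / A - x`, this yields the descent inequality
`f(θ_{t+1}) ≤ f(θ_t) - c₁ η ‖g_t‖₁ + c₂ η² Φ(θ_t)` (`exists_adam_descent`).

*Rates.* While `f > ε > h` one has `Φ ≤ 2 f` and `f ^ τ ≥ const · f`, so a small constant `η` gives
geometric decay. When `ε ≤ h`, `Φ` is only bounded, and `η` proportional to `ε ^ (2 τ)` keeps the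
second-order term below half of the first-order one; then `f` drops by `const · η f ^ τ` in each
step. As `f ^ τ ≥ w √f`, with `w` constant for `τ ≤ 1 / 2` and `w = ε ^ (τ - 1 / 2)` otherwise,
`√f` drops by a fixed amount in each step, which bounds the number of steps by a multiple of
`1 / (ε ^ (2 τ) w)`.
-/

/-! ### Comparison of norms -/

theorem lpNorm_le_card_mul {D : ℕ} (p : ENNReal) [Fact (1 ≤ p)] (x : EuclideanSpace ℝ (Fin D))
    {r : ℝ} (hr : 0 ≤ r) (hx : ∀ i, |x i| ≤ r) :
    lpNorm p x ≤ (D : ℝ) ^ (p⁻¹).toReal * r := by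
  have h := (PiLp.antilipschitzWith_ofLp p (fun _ : Fin D => ℝ)).le_mul_dist
    (WithLp.toLp p (WithLp.ofLp x)) 0
  have h2 : ‖WithLp.ofLp x‖ ≤ r := (pi_norm_le_iff_of_nonneg hr).2 hx
  simp only [dist_zero_right, WithLp.ofLp_zero, Fintype.card_fin, one_div, NNReal.coe_rpow,
    NNReal.coe_natCast] at h
  exact h.trans (by gcongr)

theorem lpNorm_le_sum_abs {D : ℕ} (q : ENNReal) [Fact (1 ≤ q)] (y : EuclideanSpace ℝ (Fin D)) :
    lpNorm q y ≤ ∑ i, |y i| := by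
  have h : WithLp.toLp q (WithLp.ofLp y) = ∑ i, PiLp.single q i (y i) := by
    ext j
    simp [Finset.sum_apply]
  unfold lpNorm
  rw [h]
  refine (norm_sum_le _ _).trans (le_of_eq ?_)
  simp

theorem sum_abs_le_card_mul_lpNorm {D : ℕ} {p q : ENNReal} [Fact (1 ≤ p)] [Fact (1 ≤ q)]
    (hpq : p⁻¹ + q⁻¹ = 1) (y : EuclideanSpace ℝ (Fin D)) :
    ∑ i, |y i| ≤ (D : ℝ) ^ (p⁻¹).toReal * lpNorm q y := by
  have hq1 : 1 ≤ q := Fact.out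
  have hqz : q ≠ 0 := (zero_lt_one.trans_le hq1).ne'
  rcases eq_or_ne q ⊤ with rfl | hq
  · have hp : p⁻¹ = 1 := by simpa using hpq
    rw [hp]
    have : ∀ i ∈ Finset.univ, |y i| ≤ lpNorm ⊤ y := fun i _ =>
      PiLp.norm_apply_le (WithLp.toLp ⊤ (WithLp.ofLp y)) i
    simpa using Finset.sum_le_card_nsmul _ _ _ this
  · have hq0 : 0 < q.toReal := ENNReal.toReal_pos hqz hq
    have hq1' : 1 ≤ q.toReal := by simpa using ENNReal.toReal_mono hq hq1
    have hp : (p⁻¹).toReal = 1 - 1 / q.toReal := by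
      have hp1 : p⁻¹ ≠ ⊤ := by
        intro h; rw [h] at hpq; simp at hpq
      have := congrArg ENNReal.toReal hpq
      rw [ENNReal.toReal_add hp1 (ENNReal.inv_ne_top.2 hqz)] at this
      simp only [ENNReal.toReal_inv, ENNReal.toReal_one, one_div] at this ⊢
      linarith
    have hS : 0 ≤ ∑ i, |y i| := Finset.sum_nonneg fun i _ => abs_nonneg _
    have hSq : 0 ≤ ∑ i, |y i| ^ q.toReal :=
      Finset.sum_nonneg fun i _ => Real.rpow_nonneg (abs_nonneg _) _
    have hJ := Real.rpow_sum_le_const_mul_sum_rpow (s := Finset.univ) (f := fun i => y i) hq1'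
    unfold lpNorm
    rw [PiLp.norm_eq_sum hq0, hp]
    have h1 : ∑ i, |y i| = ((∑ i, |y i|) ^ q.toReal) ^ (1 / q.toReal) := by
      rw [← Real.rpow_mul hS]
      rw [mul_one_div_cancel hq0.ne', Real.rpow_one]
    rw [h1]
    refine (Real.rpow_le_rpow (Real.rpow_nonneg hS _) hJ (one_div_nonneg.2 hq0.le)).trans
      (le_of_eq ?_)
    rw [Real.mul_rpow (Real.rpow_nonneg (Nat.cast_nonneg _) _) hSq,
      ← Real.rpow_mul (Nat.cast_nonneg _)]
    congr 2
    · simp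
    · field_simp

/-! ### Smoothness from `ℓ^∞` to `ℓ¹` -/

/-- The regularity of the objective that drives the analysis, in the pair of norms `ℓ^∞`, `ℓ¹`:
`f` is twice differentiable and `∇²f(θ)`, as an operator from `ℓ^∞` to `ℓ¹`, has norm at most
`L (f(θ) + h)`. -/
structure RelativelySmooth {D : ℕ} (L h : ℝ) (f : EuclideanSpace ℝ (Fin D) → ℝ) : Prop where
  diff : Differentiable ℝ f
  diff_gradient : Differentiable ℝ (gradient f)
  nonneg : ∀ θ, 0 ≤ f θ
  sum_abs_le : ∀ (θ Δ : EuclideanSpace ℝ (Fin D)) (r : ℝ), 0 ≤ r → (∀ i, |Δ i| ≤ r) →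
    ∑ i, |fderiv ℝ (gradient f) θ Δ i| ≤ L * r * (f θ + h)

theorem toLpLin_hessian_apply {D : ℕ} (p q : ENNReal) [Fact (1 ≤ p)] [Fact (1 ≤ q)]
    (f : EuclideanSpace ℝ (Fin D) → ℝ) (θ Δ : EuclideanSpace ℝ (Fin D)) :
    Matrix.toLpLin p q (hessian f θ) (WithLp.toLp p (WithLp.ofLp Δ)) =
      WithLp.toLp q (WithLp.ofLp (fderiv ℝ (gradient f) θ Δ)) := by
  ext i
  have h : Δ = ∑ j, Δ j • EuclideanSpace.single j (1 : ℝ) := by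
    ext k
    simp [Finset.sum_apply, Pi.single_apply]
  conv_rhs => rw [h]
  simp [Matrix.toLpLin_apply, Matrix.mulVec, dotProduct, hessian, mul_comm]

/-- Both passages, from `ℓ^∞` to `ℓᵖ` and from `ℓ^q` to `ℓ¹`, cost the factor `D ^ (1 / p)`. -/
theorem ObjectiveAssumptions.relativelySmooth {D : ℕ} {p q : ENNReal} [Fact (1 ≤ p)]
    [Fact (1 ≤ q)] (hpq : p⁻¹ + q⁻¹ = 1) {H₀ H₁ τ μ K : ℝ} (hH₀ : 0 ≤ H₀) (hH₁ : 0 < H₁)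
    (hK : (D : ℝ) ^ (p⁻¹).toReal ≤ K)
    {f : EuclideanSpace ℝ (Fin D) → ℝ} (hf : ObjectiveAssumptions p q H₀ H₁ τ μ f) :
    RelativelySmooth (K ^ 2 * H₁) (H₀ / H₁) f := by
  refine ⟨hf.twiceDiff.1, hf.twiceDiff.2, hf.nonneg, fun θ Δ r hr hΔ => ?_⟩
  have hD : 0 ≤ (D : ℝ) ^ (p⁻¹).toReal := by positivity
  have hK0 : 0 ≤ K := hD.trans hK
  have hf0 := hf.nonneg θ
  set y := fderiv ℝ (gradient f) θ Δ
  have h1 : lpNorm q y ≤ inducedNorm p q (hessian f θ) * lpNorm p Δ := by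
    have := (LinearMap.toContinuousLinearMap
      (Matrix.toLpLin p q (hessian f θ))).le_opNorm (WithLp.toLp p (WithLp.ofLp Δ))
    rwa [LinearMap.coe_toContinuousLinearMap', toLpLin_hessian_apply] at this
  have h2 : lpNorm p Δ ≤ K * r :=
    (lpNorm_le_card_mul p Δ hr hΔ).trans (by gcongr)
  have h3 : lpNorm q y ≤ (H₀ + H₁ * f θ) * (K * r) :=
    h1.trans (mul_le_mul (hf.smooth θ) h2 (norm_nonneg _) (by positivity))
  calc ∑ i, |y i| ≤ (D : ℝ) ^ (p⁻¹).toReal * lpNorm q y := sum_abs_le_card_mul_lpNorm hpq y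
    _ ≤ K * ((H₀ + H₁ * f θ) * (K * r)) :=
      mul_le_mul hK h3 (norm_nonneg _) hK0
    _ = K ^ 2 * H₁ * r * (f θ + H₀ / H₁) := by field_simp; ring

/-! ### Growth along a segment -/

/-- A nonnegative function on the line with `φ'' ≤ a² φ` satisfies `φ' ≥ -a φ`: otherwise
`φ' + a φ`, which grows at most like `exp (a s)`, would drive `φ` below zero. -/
theorem neg_mul_le_deriv_of_second_deriv_le {φ φ' φ'' : ℝ → ℝ} {a : ℝ} (ha : 0 < a)
    (h1 : ∀ s, HasDerivAt φ (φ' s) s) (h2 : ∀ s, HasDerivAt φ' (φ'' s) s)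
    (h0 : ∀ s, 0 ≤ φ s) (hle : ∀ s, φ'' s ≤ a ^ 2 * φ s) : -(a * φ 0) ≤ φ' 0 := by
  by_contra! hneg
  set u0 := φ' 0 + a * φ 0 with hu0
  have hu0n : u0 < 0 := by linarith
  have hE : ∀ s : ℝ, HasDerivAt (fun s => Real.exp (a * s)) (Real.exp (a * s) * a) s := fun s => by
    simpa using ((hasDerivAt_id s).const_mul a).exp
  have hE' : ∀ s : ℝ, HasDerivAt (fun s => Real.exp (-a * s)) (Real.exp (-a * s) * (-a)) s :=
    fun s => by simpa using ((hasDerivAt_id s).const_mul (-a)).exp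
  have hu : ∀ s, 0 ≤ s → φ' s + a * φ s ≤ u0 * Real.exp (a * s) := by
    have hd : ∀ s, HasDerivAt (fun s => Real.exp (-a * s) * (φ' s + a * φ s))
        (Real.exp (-a * s) * (-a) * (φ' s + a * φ s)
          + Real.exp (-a * s) * (φ'' s + a * φ' s)) s :=
      fun s => (hE' s).mul ((h2 s).add ((h1 s).const_mul a))
    have hanti : Antitone fun s => Real.exp (-a * s) * (φ' s + a * φ s) := by
      refine antitone_of_deriv_nonpos (fun s => (hd s).differentiableAt) fun s => ?_
      rw [(hd s).deriv]
      have : Real.exp (-a * s) * (-a) * (φ' s + a * φ s)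
          + Real.exp (-a * s) * (φ'' s + a * φ' s)
          = Real.exp (-a * s) * (φ'' s - a ^ 2 * φ s) := by ring
      rw [this]
      exact mul_nonpos_of_nonneg_of_nonpos (Real.exp_pos _).le (by linarith [hle s])
    intro s hs
    have := hanti hs
    simp only [mul_zero, Real.exp_zero, one_mul] at this
    have hm := mul_le_mul_of_nonneg_right this (Real.exp_pos (a * s)).le
    have he : Real.exp (-a * s) * Real.exp (a * s) = 1 := by
      rw [← Real.exp_add]; simp
    calc φ' s + a * φ s = Real.exp (-a * s) * Real.exp (a * s) * (φ' s + a * φ s) := by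
          rw [he, one_mul]
      _ = Real.exp (-a * s) * (φ' s + a * φ s) * Real.exp (a * s) := by ring
      _ ≤ u0 * Real.exp (a * s) := hm
  -- Hence `exp (a s) φ(s)` decreases at least at the rate `-u0`.
  have hd : ∀ s, HasDerivAt (fun s => Real.exp (a * s) * φ s - u0 * s)
      (Real.exp (a * s) * a * φ s + Real.exp (a * s) * φ' s - u0 * 1) s :=
    fun s => ((hE s).mul (h1 s)).sub ((hasDerivAt_id s).const_mul u0)
  have hanti : AntitoneOn (fun s => Real.exp (a * s) * φ s - u0 * s) (Set.Ici 0) := by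
    refine antitoneOn_of_deriv_nonpos (convex_Ici 0)
      (fun s _ => (hd s).continuousAt.continuousWithinAt)
      (fun s _ => (hd s).differentiableAt.differentiableWithinAt) fun s hs => ?_
    rw [interior_Ici] at hs
    have hs0 : (0 : ℝ) < s := hs
    rw [(hd s).deriv]
    have h1e : 1 ≤ Real.exp (a * s) := Real.one_le_exp (by positivity)
    have := mul_le_mul_of_nonneg_left (hu s hs0.le) (Real.exp_pos (a * s)).le
    have h2e : 0 ≤ Real.exp (a * s) * Real.exp (a * s) - 1 := by nlinarith
    nlinarith [mul_nonneg (neg_nonneg.2 hu0n.le) h2e]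
  set S := (φ 0 + 1) / (-u0) with hS
  have hS0 : 0 ≤ S := div_nonneg (by linarith [h0 0]) (by linarith)
  have := hanti (Set.mem_Ici.2 le_rfl) (Set.mem_Ici.2 hS0) hS0
  have hSu : u0 * S = -(φ 0 + 1) := by
    rw [hS, div_neg, mul_neg, mul_div_cancel₀ _ hu0n.ne]
  simp only [mul_zero, Real.exp_zero, one_mul, hSu] at this
  have := mul_nonneg (Real.exp_pos (a * S)).le (h0 S)
  linarith

/-- The growth bound on a unit interval. Nonnegativity on the whole line is what excludes a
large initial slope. -/
theorem le_exp_mul_of_second_deriv_le {φ φ' φ'' : ℝ → ℝ} {a : ℝ} (ha : 0 < a)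
    (h1 : ∀ s, HasDerivAt φ (φ' s) s) (h2 : ∀ s, HasDerivAt φ' (φ'' s) s)
    (h0 : ∀ s, 0 ≤ φ s) (hle : ∀ s, φ'' s ≤ a ^ 2 * φ s) :
    φ 1 ≤ Real.exp a * φ 0 := by
  -- The reflected function `s ↦ φ (t - s)` gives `φ' t ≤ a φ t`.
  have key : ∀ t, φ' t ≤ a * φ t := by
    intro t
    have hr : ∀ s, HasDerivAt (fun s : ℝ => t - s) (-1) s := fun s => by
      simpa using (hasDerivAt_id s).const_sub t
    have := neg_mul_le_deriv_of_second_deriv_le (φ := fun s => φ (t - s))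
      (φ' := fun s => -φ' (t - s)) (φ'' := fun s => φ'' (t - s)) ha
      (fun s => ((h1 (t - s)).comp s (hr s)).congr_deriv (by ring))
      (fun s => ((h2 (t - s)).comp s (hr s)).fun_neg.congr_deriv (by ring))
      (fun s => h0 _) (fun s => hle _)
    simp only [sub_zero] at this
    linarith
  have hd : ∀ s, HasDerivAt (fun s => Real.exp (-a * s) * φ s)
      (Real.exp (-a * s) * (-a) * φ s + Real.exp (-a * s) * φ' s) s := fun s => by
    have hE' : HasDerivAt (fun s => Real.exp (-a * s)) (Real.exp (-a * s) * (-a)) s := by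
      simpa using ((hasDerivAt_id s).const_mul (-a)).exp
    exact hE'.mul (h1 s)
  have hanti : Antitone fun s => Real.exp (-a * s) * φ s := by
    refine antitone_of_deriv_nonpos (fun s => (hd s).differentiableAt) fun s => ?_
    rw [(hd s).deriv]
    nlinarith [Real.exp_pos (-a * s), key s]
  have := hanti zero_le_one
  simp only [mul_one, mul_zero, Real.exp_zero, one_mul, Real.exp_neg] at this
  rwa [inv_mul_le_iff₀ (Real.exp_pos a)] at this

theorem sum_mul_le_sum_abs_mul {D : ℕ} {x y : Fin D → ℝ} {r : ℝ} (hy : ∀ i, |y i| ≤ r) :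
    ∑ i, x i * y i ≤ (∑ i, |x i|) * r := by
  rw [Finset.sum_mul]
  refine Finset.sum_le_sum fun i _ => (le_abs_self _).trans ?_
  rw [abs_mul]
  exact mul_le_mul_of_nonneg_left (hy i) (abs_nonneg _)

namespace RelativelySmooth

variable {D : ℕ} {L h : ℝ} {f : EuclideanSpace ℝ (Fin D) → ℝ}

theorem hasDerivAt_line (hf : RelativelySmooth L h f) (θ Δ : EuclideanSpace ℝ (Fin D)) (s : ℝ) :
    HasDerivAt (fun s : ℝ => f (θ + s • Δ)) (∑ i, gradient f (θ + s • Δ) i * Δ i) s := by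
  have hl : HasDerivAt (fun s : ℝ => θ + s • Δ) Δ s := by
    simpa using ((hasDerivAt_id s).smul_const Δ).const_add θ
  have := ((hf.diff (θ + s • Δ)).hasGradientAt.hasFDerivAt).comp_hasDerivAt s hl
  refine this.congr_deriv ?_
  rw [InnerProductSpace.toDual_apply_apply, PiLp.inner_apply]
  simp [mul_comm]

theorem hasDerivAt_gradient_line (hf : RelativelySmooth L h f)
    (θ Δ w : EuclideanSpace ℝ (Fin D)) (s : ℝ) :
    HasDerivAt (fun s : ℝ => ∑ i, gradient f (θ + s • Δ) i * w i)
      (∑ i, fderiv ℝ (gradient f) (θ + s • Δ) Δ i * w i) s := by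
  have hl : HasDerivAt (fun s : ℝ => θ + s • Δ) Δ s := by
    simpa using ((hasDerivAt_id s).smul_const Δ).const_add θ
  have h1 := ((hf.diff_gradient (θ + s • Δ)).hasFDerivAt).comp_hasDerivAt s hl
  refine HasDerivAt.fun_sum fun i _ => HasDerivAt.mul_const ?_ _
  exact ((EuclideanSpace.proj (𝕜 := ℝ) i).hasFDerivAt).comp_hasDerivAt s h1

theorem add_le_exp_mul (hf : RelativelySmooth L h f) (hL : 0 < L) (hh : 0 ≤ h)
    {θ Δ : EuclideanSpace ℝ (Fin D)} {r : ℝ} (hr : 0 < r) (hΔ : ∀ i, |Δ i| ≤ r) :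
    f (θ + Δ) + h ≤ Real.exp (√L * r) * (f θ + h) := by
  have := le_exp_mul_of_second_deriv_le (φ := fun s : ℝ => f (θ + s • Δ) + h)
    (a := √L * r) (by positivity)
    (fun s => (hf.hasDerivAt_line θ Δ s).add_const h)
    (fun s => hf.hasDerivAt_gradient_line θ Δ Δ s)
    (fun s => add_nonneg (hf.nonneg _) hh)
    (fun s => by
      refine (sum_mul_le_sum_abs_mul hΔ).trans ?_
      refine (mul_le_mul_of_nonneg_right (hf.sum_abs_le _ _ r hr.le hΔ) hr.le).trans
        (le_of_eq ?_)
      rw [mul_pow, Real.sq_sqrt hL.le]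
      ring)
  simpa using this

theorem sum_abs_gradient_sub_le (hf : RelativelySmooth L h f) (hL : 0 < L) (hh : 0 ≤ h)
    {θ Δ : EuclideanSpace ℝ (Fin D)} {r : ℝ} (hr : 0 < r) (hΔ : ∀ i, |Δ i| ≤ r) :
    ∑ i, |gradient f (θ + Δ) i - gradient f θ i| ≤
      L * r * (Real.exp (√L * r) * (f θ + h)) := by
  -- Test the increment against the vector `w` of its signs.
  set w : EuclideanSpace ℝ (Fin D) :=
    WithLp.toLp 2 fun i => (SignType.sign (gradient f (θ + Δ) i - gradient f θ i) : ℝ) with hw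
  have hw1 : ∀ i, |w i| ≤ 1 := fun i => by
    simp only [hw]
    rcases SignType.sign (gradient f (θ + Δ) i - gradient f θ i) with _ | _ | _ <;> simp
  obtain ⟨s, hs, heq⟩ := exists_hasDerivAt_eq_slope
    (fun s : ℝ => ∑ i, gradient f (θ + s • Δ) i * w i) _ (zero_lt_one)
    (fun s _ => (hf.hasDerivAt_gradient_line θ Δ w s).continuousAt.continuousWithinAt)
    (fun s _ => hf.hasDerivAt_gradient_line θ Δ w s)
  simp only [one_smul, zero_smul, add_zero, sub_zero, div_one] at heq
  have h1 : ∑ i, |gradient f (θ + Δ) i - gradient f θ i| =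
      ∑ i, fderiv ℝ (gradient f) (θ + s • Δ) Δ i * w i := by
    rw [heq, ← Finset.sum_sub_distrib]
    refine Finset.sum_congr rfl fun i _ => ?_
    rw [← sub_mul, hw]
    exact (self_mul_sign _).symm
  have hsΔ : ∀ i, |(s • Δ) i| ≤ r := fun i => by
    simp only [PiLp.smul_apply, smul_eq_mul, abs_mul, abs_of_pos hs.1]
    nlinarith [hΔ i, hs.1, hs.2, abs_nonneg (Δ i)]
  rw [h1]
  refine (sum_mul_le_sum_abs_mul hw1).trans ?_
  rw [mul_one]
  refine (hf.sum_abs_le _ _ r hr.le hΔ).trans ?_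
  exact mul_le_mul_of_nonneg_left (hf.add_le_exp_mul hL hh hr hsΔ) (by positivity)

/-- Taylor's formula to first order. The mean value theorem bounds the remainder through the
change of the gradient, which costs only a factor `2` against the second-order formula. -/
theorem le_add_sum_mul (hf : RelativelySmooth L h f) (hL : 0 < L) (hh : 0 ≤ h)
    {θ Δ : EuclideanSpace ℝ (Fin D)} {r : ℝ} (hr : 0 < r) (hΔ : ∀ i, |Δ i| ≤ r) :
    f (θ + Δ) ≤ f θ + ∑ i, gradient f θ i * Δ i +
      L * r ^ 2 * (Real.exp (√L * r) * (f θ + h)) := by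
  obtain ⟨s, hs, heq⟩ := exists_hasDerivAt_eq_slope
    (fun s : ℝ => f (θ + s • Δ)) _ (zero_lt_one)
    (fun s _ => (hf.hasDerivAt_line θ Δ s).continuousAt.continuousWithinAt)
    (fun s _ => hf.hasDerivAt_line θ Δ s)
  simp only [one_smul, zero_smul, add_zero, sub_zero, div_one] at heq
  have hsΔ : ∀ i, |(s • Δ) i| ≤ r := fun i => by
    simp only [PiLp.smul_apply, smul_eq_mul, abs_mul, abs_of_pos hs.1]
    nlinarith [hΔ i, hs.1, hs.2, abs_nonneg (Δ i)]
  have h1 : ∑ i, (gradient f (θ + s • Δ) i - gradient f θ i) * Δ i ≤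
      (∑ i, |gradient f (θ + s • Δ) i - gradient f θ i|) * r :=
    sum_mul_le_sum_abs_mul hΔ
  have h2 := mul_le_mul_of_nonneg_right (hf.sum_abs_gradient_sub_le (θ := θ) hL hh hr hsΔ) hr.le
  simp only [sub_mul, Finset.sum_sub_distrib] at h1
  linarith

end RelativelySmooth

/-! ### The averages of Adam and the gradient -/

/-- Constants of the analysis for a bound `r` on the coordinates of a step. `M` bounds the
normalised updates; `A`, the sum of the geometric series of ratio `√β₂`, is the factor by which
`√v` may exceed `|g|`; `e` bounds the growth of `f + h` over a step; and `κ` is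
large enough for the recursion of the errors of the two averages to preserve a bound proportional
to `κ`. -/
structure AdamConstants (β₁ β₂ L r M A κ e : ℝ) : Prop where
  β₁_nonneg : 0 ≤ β₁
  β₁_le : β₁ ≤ β₂
  β₂_lt_one : β₂ < 1
  L_pos : 0 < L
  r_pos : 0 < r
  M_pos : 0 < M
  M_sq : M ^ 2 * (1 - β₂) = 1
  one_le_A : 1 ≤ A
  A_eq : √β₂ * A + 1 = A
  κ_nonneg : 0 ≤ κ
  e_eq : e = Real.exp (√L * r)
  e_le_two : e ≤ 2
  κ_fixed : √β₂ * e * (A * L + κ) ≤ κ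

/-- How the averages `m`, `v` formed at the point `θ` relate to the gradient `g` there: both
`|m|` and `|g|` are at most `M √v`; up to an error of order `r (f(θ) + h)` in the `ℓ¹` norm, `m` is
a multiple `α g` with `1 - β₁ ≤ α ≤ 1`, and `√v` is at most `A |g|`. -/
structure AveragesTrack {D : ℕ} (f : EuclideanSpace ℝ (Fin D) → ℝ) (h β₁ r M A κ : ℝ)
    (θ m v : EuclideanSpace ℝ (Fin D)) : Prop where
  mom_sq : ∀ i, m i ^ 2 ≤ M ^ 2 * v i
  grad_sq : ∀ i, gradient f θ i ^ 2 ≤ M ^ 2 * v i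
  mom_error : ∃ α, 1 - β₁ ≤ α ∧ α ≤ 1 ∧ ∑ i, |m i - α * gradient f θ i| ≤ κ * r * (f θ + h)
  sec_error : ∑ i, max 0 (√(v i) - A * |gradient f θ i|) ≤ κ * r * (f θ + h)

theorem abs_le_mul_sqrt_of_sq_le {x M v : ℝ} (hM : 0 ≤ M) (h : x ^ 2 ≤ M ^ 2 * v) :
    |x| ≤ M * √v := by
  have := Real.sqrt_le_sqrt h
  rwa [Real.sqrt_sq_eq_abs, Real.sqrt_mul (sq_nonneg M), Real.sqrt_sq hM] at this

theorem abs_div_sqrt_le {x M v : ℝ} (hM : 0 ≤ M) (h : x ^ 2 ≤ M ^ 2 * v) : |x / √v| ≤ M := by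
  rw [abs_div, abs_of_nonneg (Real.sqrt_nonneg v)]
  exact div_le_of_le_mul₀ (Real.sqrt_nonneg v) hM (abs_le_mul_sqrt_of_sq_le hM h)

/-- A convex-combination bound: this is where `β₁ ≤ β₂` is used. -/
theorem sq_average_le {β₁ β₂ M m v g : ℝ} (hβ₁ : 0 ≤ β₁) (hβ : β₁ ≤ β₂) (hβ₂ : β₂ < 1)
    (hM : M ^ 2 * (1 - β₂) = 1) (h : m ^ 2 ≤ M ^ 2 * v) :
    (β₁ * m + (1 - β₁) * g) ^ 2 ≤ M ^ 2 * (β₂ * v + (1 - β₂) * g ^ 2) := by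
  have hconv : (β₁ * m + (1 - β₁) * g) ^ 2 ≤ β₁ * m ^ 2 + (1 - β₁) * g ^ 2 := by
    have : 0 ≤ β₁ * (1 - β₁) * (m - g) ^ 2 :=
      mul_nonneg (mul_nonneg hβ₁ (by linarith)) (sq_nonneg _)
    nlinarith
  have h1 : β₁ * m ^ 2 ≤ β₂ * (M ^ 2 * v) :=
    mul_le_mul hβ h (sq_nonneg _) (by linarith)
  have h2 : (1 - β₁) * g ^ 2 ≤ M ^ 2 * (1 - β₂) * g ^ 2 := by
    rw [hM]; nlinarith [sq_nonneg g]
  linarith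

theorem sqrt_average_le {β₂ v g : ℝ} (hβ₀ : 0 ≤ β₂) (hv : 0 ≤ v) :
    √(β₂ * v + (1 - β₂) * g ^ 2) ≤ √β₂ * √v + |g| := by
  rw [Real.sqrt_le_left (by positivity)]
  have h1 : (√β₂ * √v) ^ 2 = β₂ * v := by
    rw [mul_pow, Real.sq_sqrt hβ₀, Real.sq_sqrt hv]
  have h2 : 0 ≤ √β₂ * √v * |g| := by positivity
  nlinarith [sq_abs g, mul_nonneg hβ₀ (sq_nonneg g)]

/-- One coordinate of the recursion for the excess of `√v` over `A |g|`: the choice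
`A = √β₂ A + 1` makes the contributions of `|g'|` cancel. -/
theorem sqrt_excess_average_le {β₂ A v g g' : ℝ} (hβ₀ : 0 ≤ β₂) (hv : 0 ≤ v) (hA0 : 0 ≤ A)
    (hA : √β₂ * A + 1 = A) :
    max 0 (√(β₂ * v + (1 - β₂) * g' ^ 2) - A * |g'|) ≤
      √β₂ * (A * |g - g'| + max 0 (√v - A * |g|)) := by
  refine max_le (by positivity) ?_
  have h1 := sqrt_average_le (g := g') hβ₀ hv
  have h2 : √v ≤ A * |g| + max 0 (√v - A * |g|) := by
    linarith [le_max_right 0 (√v - A * |g|)]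
  have h3 : |g| ≤ |g'| + |g - g'| := by
    have := abs_add_le g' (g - g')
    simpa using this
  have h4 := mul_le_mul_of_nonneg_left h2 (Real.sqrt_nonneg β₂)
  have h5 := mul_le_mul_of_nonneg_left h3 (mul_nonneg (Real.sqrt_nonneg β₂) hA0)
  have h6 : √β₂ * A * |g'| = A * |g'| - |g'| := by linear_combination |g'| * hA
  nlinarith

namespace AveragesTrack

variable {D : ℕ} {f : EuclideanSpace ℝ (Fin D) → ℝ} {h β₁ β₂ L η r M A κ e : ℝ}
  {θ m v : EuclideanSpace ℝ (Fin D)}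

/-- Both initialisations of the momentum are covered: `α = 1` if `m₀ = ∇f(θ₁)` and `α = 1 - β₁`
if `m₀ = 0`. -/
theorem start (hc : AdamConstants β₁ β₂ L r M A κ e) (hf : RelativelySmooth L h f) (hh : 0 ≤ h)
    {m₀ : EuclideanSpace ℝ (Fin D)} (hm₀ : m₀ = gradient f θ ∨ m₀ = 0) :
    AveragesTrack f h β₁ r M A κ θ (adamStep f β₁ β₂ 0 η ⟨θ, m₀, 0⟩).mom
      (adamStep f β₁ β₂ 0 η ⟨θ, m₀, 0⟩).sec := by
  have hΦ : 0 ≤ κ * r * (f θ + h) :=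
    mul_nonneg (mul_nonneg hc.κ_nonneg hc.r_pos.le) (add_nonneg (hf.nonneg θ) hh)
  have hβ₁1 : β₁ < 1 := hc.β₁_le.trans_lt hc.β₂_lt_one
  have hβ₁0 := hc.β₁_nonneg
  have hβ₂0 : 0 ≤ β₂ := hc.β₁_nonneg.trans hc.β₁_le
  obtain ⟨α, hα1, hα2, hα⟩ : ∃ α, 1 - β₁ ≤ α ∧ α ≤ 1 ∧
      ∀ i, β₁ * m₀ i + (1 - β₁) * gradient f θ i = α * gradient f θ i := by
    rcases hm₀ with rfl | rfl
    · exact ⟨1, by linarith, le_rfl, fun i => by ring⟩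
    · exact ⟨1 - β₁, le_rfl, by linarith, fun i => by simp⟩
  have hv : ∀ i, M ^ 2 * (adamStep f β₁ β₂ 0 η ⟨θ, m₀, 0⟩).sec i = gradient f θ i ^ 2 := by
    intro i
    simp only [adamStep, PiLp.zero_apply, mul_zero, zero_add]
    rw [← mul_assoc, hc.M_sq, one_mul]
  refine ⟨fun i => ?_, fun i => (hv i).ge, ⟨α, hα1, hα2, ?_⟩, ?_⟩
  · rw [hv]
    simp only [adamStep, hα]
    rw [mul_pow]
    have : α ^ 2 ≤ 1 := by nlinarith
    nlinarith [sq_nonneg (gradient f θ i)]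
  · simpa [adamStep, hα] using hΦ
  · refine (Finset.sum_nonpos fun i _ => ?_).trans hΦ
    refine max_le le_rfl ?_
    have h1 := sqrt_average_le (v := 0) (g := gradient f θ i) hβ₂0 le_rfl
    simp only [Real.sqrt_zero, mul_zero, zero_add] at h1
    simp only [adamStep, PiLp.zero_apply, mul_zero, zero_add]
    nlinarith [hc.one_le_A, abs_nonneg (gradient f θ i)]

/-- Moving to a point `θ'` at distance at most `r` and averaging with the gradient there preserves
the bounds: both errors are first multiplied by a number below one, then increased by the change of
the gradient, and `κ` absorbs that increase. -/
theorem step (hc : AdamConstants β₁ β₂ L r M A κ e) (hf : RelativelySmooth L h f) (hh : 0 ≤ h)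
    (ht : AveragesTrack f h β₁ r M A κ θ m v) {θ' : EuclideanSpace ℝ (Fin D)}
    (hθ' : ∀ i, |θ i - θ' i| ≤ r) :
    AveragesTrack f h β₁ r M A κ θ' (adamStep f β₁ β₂ 0 η ⟨θ', m, v⟩).mom
      (adamStep f β₁ β₂ 0 η ⟨θ', m, v⟩).sec := by
  have hβ₁1 : β₁ < 1 := hc.β₁_le.trans_lt hc.β₂_lt_one
  have hβ₁0 := hc.β₁_nonneg
  have hβ₂0 : 0 ≤ β₂ := hc.β₁_nonneg.trans hc.β₁_le
  have hA0 : 0 ≤ A := zero_le_one.trans hc.one_le_A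
  have hb : β₁ ≤ √β₂ := by
    refine hc.β₁_le.trans (Real.le_sqrt_of_sq_le ?_)
    nlinarith [hc.β₂_lt_one]
  have hM2 : 0 < M ^ 2 := pow_pos hc.M_pos 2
  have hv : ∀ i, 0 ≤ v i := fun i =>
    nonneg_of_mul_nonneg_right ((sq_nonneg _).trans (ht.grad_sq i)) hM2
  have hΦ : 0 ≤ f θ' + h := add_nonneg (hf.nonneg θ') hh
  have hΔ : ∀ i, |(θ - θ') i| ≤ r := hθ'
  have hgrow : f θ + h ≤ e * (f θ' + h) := by
    have := hf.add_le_exp_mul (θ := θ') hc.L_pos hh hc.r_pos hΔ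
    rwa [add_sub_cancel, ← hc.e_eq] at this
  have hgrad : ∑ i, |gradient f θ i - gradient f θ' i| ≤ L * r * (e * (f θ' + h)) := by
    have := hf.sum_abs_gradient_sub_le (θ := θ') hc.L_pos hh hc.r_pos hΔ
    rwa [add_sub_cancel, ← hc.e_eq] at this
  have hκr : 0 ≤ κ * r := mul_nonneg hc.κ_nonneg hc.r_pos.le
  have hfix : √β₂ * (A * (L * r * (e * (f θ' + h))) + κ * r * (e * (f θ' + h))) ≤
      κ * r * (f θ' + h) := by
    have := mul_le_mul_of_nonneg_right hc.κ_fixed (mul_nonneg hc.r_pos.le hΦ)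
    linarith
  refine ⟨fun i => sq_average_le hβ₁0 hc.β₁_le hc.β₂_lt_one hc.M_sq (ht.mom_sq i),
    fun i => ?_, ?_, ?_⟩
  · simp only [adamStep]
    have := mul_nonneg hM2.le (mul_nonneg hβ₂0 (hv i))
    nlinarith [hc.M_sq]
  · obtain ⟨α, hα1, hα2, hα⟩ := ht.mom_error
    refine ⟨β₁ * α + (1 - β₁), by nlinarith, by nlinarith, ?_⟩
    have hpt : ∀ i, |(adamStep f β₁ β₂ 0 η ⟨θ', m, v⟩).mom i -
        (β₁ * α + (1 - β₁)) * gradient f θ' i| ≤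
        √β₂ * (|m i - α * gradient f θ i| + A * |gradient f θ i - gradient f θ' i|) := by
      intro i
      simp only [adamStep]
      have h1 : β₁ * m i + (1 - β₁) * gradient f θ' i -
          (β₁ * α + (1 - β₁)) * gradient f θ' i =
          β₁ * ((m i - α * gradient f θ i) + α * (gradient f θ i - gradient f θ' i)) := by ring
      have hα0 : 0 ≤ α := by linarith
      rw [h1, abs_mul, abs_of_nonneg hβ₁0]
      refine mul_le_mul hb ((abs_add_le _ _).trans ?_) (abs_nonneg _) (Real.sqrt_nonneg _)
      rw [abs_mul, abs_of_nonneg hα0]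
      gcongr
      exact hα2.trans hc.one_le_A
    refine (Finset.sum_le_sum fun i _ => hpt i).trans ?_
    rw [← Finset.mul_sum, Finset.sum_add_distrib, ← Finset.mul_sum]
    refine le_trans ?_ hfix
    refine mul_le_mul_of_nonneg_left ?_ (Real.sqrt_nonneg _)
    rw [add_comm]
    exact add_le_add (mul_le_mul_of_nonneg_left hgrad hA0)
      (hα.trans (mul_le_mul_of_nonneg_left hgrow hκr))
  · refine (Finset.sum_le_sum fun i _ =>
      sqrt_excess_average_le (g := gradient f θ i) hβ₂0 (hv i) hA0 hc.A_eq).trans ?_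
    rw [← Finset.mul_sum, Finset.sum_add_distrib, ← Finset.mul_sum]
    refine le_trans ?_ hfix
    refine mul_le_mul_of_nonneg_left ?_ (Real.sqrt_nonneg _)
    exact add_le_add (mul_le_mul_of_nonneg_left hgrad hA0)
      (ht.sec_error.trans (mul_le_mul_of_nonneg_left hgrow hκr))

end AveragesTrack

/-! ### The descent inequality -/

/-- One coordinate of the correlation between the gradient and the update. If `√v ≤ A |g| + x`,
then `g² / √v ≥ |g| / A - x`, and replacing `m` by `α g` costs at most `M |m - α g|`. -/
theorem correlation_ge {β₁ M A α g m v : ℝ} (hβ₁ : β₁ ≤ 1) (hβ₁0 : 0 ≤ β₁) (hM : 0 ≤ M)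
    (hA : 1 ≤ A) (hα : 1 - β₁ ≤ α) (hg : g ^ 2 ≤ M ^ 2 * v) :
    (1 - β₁) / A * |g| - max 0 (√v - A * |g|) - M * |m - α * g| ≤ g * (m / √v) := by
  have hA0 : 0 < A := zero_lt_one.trans_le hA
  set x := max 0 (√v - A * |g|) with hx
  have hx0 : 0 ≤ x := le_max_left _ _
  have hxv : √v ≤ A * |g| + x := by linarith [le_max_right 0 (√v - A * |g|)]
  have hgv := abs_div_sqrt_le hM hg
  have h1 : |g| / A - x ≤ g * (g / √v) := by
    rcases (Real.sqrt_nonneg v).eq_or_lt with hs | hs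
    · have : |g| ≤ 0 := by simpa [← hs] using abs_le_mul_sqrt_of_sq_le hM hg
      have hg0 : g = 0 := abs_nonpos_iff.1 this
      simpa [hg0] using hx0
    · rw [← mul_div_assoc, le_div_iff₀ hs]
      rcases le_total (|g| / A - x) 0 with hn | hp
      · exact (mul_nonpos_of_nonpos_of_nonneg hn hs.le).trans (mul_self_nonneg g)
      · refine (mul_le_mul_of_nonneg_left hxv hp).trans ?_
        have h2 : |g| / A * A = |g| := div_mul_cancel₀ _ hA0.ne'
        have h3 : |g| / A ≤ A * |g| := by
          rw [div_le_iff₀ hA0]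
          nlinarith [abs_nonneg g, mul_le_mul hA hA zero_le_one hA0.le]
        have h4 : (|g| / A - x) * (A * |g| + x) = g * g - x * (A * |g| - |g| / A) - x ^ 2 := by
          linear_combination |g| * h2 + abs_mul_abs_self g
        linarith [mul_nonneg hx0 (sub_nonneg.2 h3), sq_nonneg x]
  have h2 : 0 ≤ g * (g / √v) := by
    rw [← mul_div_assoc]; exact div_nonneg (mul_self_nonneg g) (Real.sqrt_nonneg v)
  have h3 : -(M * |m - α * g|) ≤ (m - α * g) * (g / √v) := by
    refine neg_le_of_neg_le ?_
    refine (neg_le_abs _).trans ?_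
    rw [abs_mul, mul_comm]
    exact mul_le_mul_of_nonneg_right hgv (abs_nonneg _)
  have h4 : g * (m / √v) = α * (g * (g / √v)) + (m - α * g) * (g / √v) := by ring
  have h5 : (1 - β₁) / A * |g| - x ≤ α * (g * (g / √v)) := by
    have h6 : (1 - β₁) * (g * (g / √v)) ≤ α * (g * (g / √v)) :=
      mul_le_mul_of_nonneg_right hα h2
    have h7 := mul_le_mul_of_nonneg_left h1 (sub_nonneg.2 hβ₁)
    have h8 : (1 - β₁) / A * |g| = (1 - β₁) * (|g| / A) := by ring
    nlinarith [mul_nonneg hβ₁0 hx0]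
  linarith

namespace AveragesTrack

variable {D : ℕ} {f : EuclideanSpace ℝ (Fin D) → ℝ} {h β₁ β₂ L η M A κ e : ℝ}
  {θ m v : EuclideanSpace ℝ (Fin D)}

theorem abs_update_le {r : ℝ} (ht : AveragesTrack f h β₁ r M A κ θ m v) (hM : 0 ≤ M)
    (hη : 0 ≤ η) (i : Fin D) : |η * (m i / √(v i))| ≤ η * M := by
  rw [abs_mul, abs_of_nonneg hη]
  exact mul_le_mul_of_nonneg_left (abs_div_sqrt_le hM (ht.mom_sq i)) hη

/-- The descent inequality for one step of Adam. -/
theorem descent (hc : AdamConstants β₁ β₂ L (η * M) M A κ e) (hf : RelativelySmooth L h f)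
    (hh : 0 ≤ h) (hη : 0 < η) (ht : AveragesTrack f h β₁ (η * M) M A κ θ m v)
    {θ' : EuclideanSpace ℝ (Fin D)} (hθ' : ∀ i, θ' i = θ i - η * (m i / √(v i))) :
    f θ' ≤ f θ - (1 - β₁) / A * η * ∑ i, |gradient f θ i| +
      (κ * M * (1 + M) + 2 * L * M ^ 2) * η ^ 2 * (f θ + h) := by
  have hβ₁1 : β₁ < 1 := hc.β₁_le.trans_lt hc.β₂_lt_one
  have hM := hc.M_pos
  have hΦ : 0 ≤ f θ + h := add_nonneg (hf.nonneg θ) hh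
  set Δ : EuclideanSpace ℝ (Fin D) := WithLp.toLp 2 fun i => -(η * (m i / √(v i))) with hΔ
  have hθΔ : θ' = θ + Δ := by
    ext i
    simp [hθ', hΔ, sub_eq_add_neg]
  have hΔr : ∀ i, |Δ i| ≤ η * M := fun i => by
    simpa [hΔ] using ht.abs_update_le hM.le hη.le i
  have h1 := hf.le_add_sum_mul (θ := θ) hc.L_pos hh hc.r_pos hΔr
  rw [← hθΔ, ← hc.e_eq] at h1
  obtain ⟨α, hα1, -, hα⟩ := ht.mom_error
  have h2 : (1 - β₁) / A * ∑ i, |gradient f θ i| - κ * (η * M) * (f θ + h) -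
      M * (κ * (η * M) * (f θ + h)) ≤ ∑ i, gradient f θ i * (m i / √(v i)) := by
    have := Finset.sum_le_sum fun i (_ : i ∈ Finset.univ) =>
      correlation_ge (m := m i) hβ₁1.le hc.β₁_nonneg hM.le hc.one_le_A hα1 (ht.grad_sq i)
    simp only [Finset.sum_sub_distrib, ← Finset.mul_sum] at this
    have h3 := mul_le_mul_of_nonneg_left hα hM.le
    linarith [ht.sec_error]
  have h3 : ∑ i, gradient f θ i * Δ i = -(η * ∑ i, gradient f θ i * (m i / √(v i))) := by
    rw [Finset.mul_sum, ← Finset.sum_neg_distrib]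
    refine Finset.sum_congr rfl fun i _ => ?_
    simp only [hΔ]
    ring
  have h4 := mul_le_mul_of_nonneg_left h2 hη.le
  have h5 : L * (η * M) ^ 2 * (e * (f θ + h)) ≤ L * (η * M) ^ 2 * (2 * (f θ + h)) :=
    mul_le_mul_of_nonneg_left (mul_le_mul_of_nonneg_right hc.e_le_two hΦ)
      (mul_nonneg hc.L_pos.le (sq_nonneg _))
  rw [h3] at h1
  linarith

end AveragesTrack

theorem adam_succ {D : ℕ} (f : EuclideanSpace ℝ (Fin D) → ℝ) (β₁ β₂ δ η : ℝ)
    (θ₁ m₀ : EuclideanSpace ℝ (Fin D)) (t : ℕ) :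
    adam f β₁ β₂ δ η θ₁ m₀ (t + 1) = adamStep f β₁ β₂ δ η (adam f β₁ β₂ δ η θ₁ m₀ t) :=
  Function.iterate_succ_apply' _ _ _

theorem adamStep_pos_apply {D : ℕ} (f : EuclideanSpace ℝ (Fin D) → ℝ) (β₁ β₂ η : ℝ)
    (s : AdamState D) (i : Fin D) :
    (adamStep f β₁ β₂ 0 η s).pos i = s.pos i -
      η * ((adamStep f β₁ β₂ 0 η s).mom i / √((adamStep f β₁ β₂ 0 η s).sec i)) := by
  simp [adamStep]

theorem averagesTrack_adam {D : ℕ} {f : EuclideanSpace ℝ (Fin D) → ℝ}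
    {h β₁ β₂ L η M A κ e : ℝ} (hc : AdamConstants β₁ β₂ L (η * M) M A κ e)
    (hf : RelativelySmooth L h f) (hh : 0 ≤ h) (hη : 0 < η)
    {θ₁ m₀ : EuclideanSpace ℝ (Fin D)} (hm₀ : m₀ = gradient f θ₁ ∨ m₀ = 0) (t : ℕ) :
    AveragesTrack f h β₁ (η * M) M A κ (adam f β₁ β₂ 0 η θ₁ m₀ t).pos
      (adam f β₁ β₂ 0 η θ₁ m₀ (t + 1)).mom (adam f β₁ β₂ 0 η θ₁ m₀ (t + 1)).sec := by
  induction t with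
  | zero => exact AveragesTrack.start hc hf hh hm₀
  | succ t ih =>
    rw [adam_succ _ _ _ _ _ _ _ (t + 1)]
    refine ih.step hc hf hh fun i => ?_
    rw [adam_succ, adamStep_pos_apply, ← adam_succ, sub_sub_cancel]
    exact ih.abs_update_le hc.M_pos.le hη.le i

/-- For step-sizes below a threshold depending on `L`, `β₁`, `β₂` only, every step of Adam lowers
`f` in proportion to `η ‖∇f‖₁`, up to a term of second order in `η`. -/
theorem exists_adam_descent {L β₁ β₂ : ℝ} (hL : 0 < L) (hβ₁ : 0 ≤ β₁) (hβ : β₁ ≤ β₂)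
    (hβ₂ : β₂ < 1) :
    ∃ η₀ c₁ c₂ : ℝ, 0 < η₀ ∧ 0 < c₁ ∧ 0 < c₂ ∧ ∀ η : ℝ, 0 < η → η ≤ η₀ →
      ∀ (h : ℝ), 0 ≤ h → ∀ (D : ℕ) (f : EuclideanSpace ℝ (Fin D) → ℝ), RelativelySmooth L h f →
      ∀ θ₁ m₀ : EuclideanSpace ℝ (Fin D), (m₀ = gradient f θ₁ ∨ m₀ = 0) → ∀ t : ℕ,
        f (adam f β₁ β₂ 0 η θ₁ m₀ (t + 1)).pos ≤ f (adam f β₁ β₂ 0 η θ₁ m₀ t).pos -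
          c₁ * η * ∑ i, |gradient f (adam f β₁ β₂ 0 η θ₁ m₀ t).pos i| +
          c₂ * η ^ 2 * (f (adam f β₁ β₂ 0 η θ₁ m₀ t).pos + h) := by
  have hβ₂0 : 0 ≤ β₂ := hβ₁.trans hβ
  set b := √β₂ with hb
  have hb0 : 0 ≤ b := Real.sqrt_nonneg _
  have hb1 : b < 1 := by
    rw [hb, Real.sqrt_lt' one_pos]; simpa using hβ₂
  have h1b : 0 < 1 - b := by linarith
  set M := 1 / √(1 - β₂) with hMdef
  have hs : 0 < √(1 - β₂) := Real.sqrt_pos.2 (by linarith)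
  have hM : 0 < M := by positivity
  have hM2 : M ^ 2 * (1 - β₂) = 1 := by
    rw [hMdef, div_pow, Real.sq_sqrt (by linarith), one_pow]
    exact one_div_mul_cancel (by linarith)
  set A := 1 / (1 - b) with hAdef
  have hA1 : A * (1 - b) = 1 := one_div_mul_cancel h1b.ne'
  have hA : 1 ≤ A := by rw [hAdef, le_div_iff₀ h1b]; linarith
  -- The growth factor `e ≤ 2 / (1 + b)` makes `b e ≤ 2 b / (1 + b) < 1`.
  set κ := 2 * b * A * L / (1 - b) with hκdef
  have hκ : 0 ≤ κ := by positivity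
  have hκ1 : κ * (1 - b) = 2 * b * A * L := div_mul_cancel₀ _ h1b.ne'
  have hlog : 0 < Real.log (2 / (1 + b)) :=
    Real.log_pos (by rw [lt_div_iff₀ (by linarith)]; linarith)
  have hsL : 0 < √L := Real.sqrt_pos.2 hL
  refine ⟨Real.log (2 / (1 + b)) / (√L * M), (1 - β₁) / A, κ * M * (1 + M) + 2 * L * M ^ 2,
    by positivity, div_pos (by linarith) (by linarith), by positivity, ?_⟩
  intro η hη hη₀ h hh D f hf θ₁ m₀ hm₀ t
  have he : Real.exp (√L * (η * M)) ≤ 2 / (1 + b) := by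
    rw [← Real.le_log_iff_exp_le (by positivity)]
    rw [le_div_iff₀ (by positivity)] at hη₀
    linarith
  have he1 : Real.exp (√L * (η * M)) * (1 + b) ≤ 2 := by
    rwa [le_div_iff₀ (by positivity)] at he
  have hc : AdamConstants β₁ β₂ L (η * M) M A κ (Real.exp (√L * (η * M))) := by
    refine ⟨hβ₁, hβ, hβ₂, hL, by positivity, hM, hM2, hA, ?_, hκ, rfl, ?_, ?_⟩
    · rw [← hb]; linarith
    · nlinarith [Real.exp_pos (√L * (η * M))]
    · rw [← hb]
      have h2 : (b * Real.exp (√L * (η * M)) * (A * L + κ)) * (1 + b) ≤ κ * (1 + b) := by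
        have h3 := mul_le_mul_of_nonneg_left he1
          (by positivity : 0 ≤ b * (A * L + κ))
        linarith
      exact le_of_mul_le_mul_right h2 (by linarith)
  refine (averagesTrack_adam hc hf hh hη hm₀ t).descent hc hf hh hη fun i => ?_
  rw [adam_succ]
  exact adamStep_pos_apply _ _ _ _ _ _

/-- The descent inequality under the standing assumptions. Its constants do not depend on `H₀`,
which enters through `H₀ / H₁` only. -/
theorem exists_adam_descent_of_objectiveAssumptions (p q : ENNReal) [Fact (1 ≤ p)] [Fact (1 ≤ q)]
    (hpq : p⁻¹ + q⁻¹ = 1) {H₁ τ μ β₁ β₂ : ℝ} (K : ℝ) (hH₁ : 0 < H₁) (hβ₁ : 0 ≤ β₁)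
    (hβ : β₁ ≤ β₂) (hβ₂ : β₂ < 1) :
    ∃ η₀ c₁ c₂ : ℝ, 0 < η₀ ∧ 0 < c₁ ∧ 0 < c₂ ∧ ∀ η : ℝ, 0 < η → η ≤ η₀ →
      ∀ (H₀ : ℝ), 0 ≤ H₀ → ∀ (D : ℕ), (D : ℝ) ^ (p⁻¹).toReal ≤ K →
      ∀ f : EuclideanSpace ℝ (Fin D) → ℝ, ObjectiveAssumptions p q H₀ H₁ τ μ f →
      ∀ θ₁ m₀ : EuclideanSpace ℝ (Fin D), (m₀ = gradient f θ₁ ∨ m₀ = 0) → ∀ t : ℕ,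
        f (adam f β₁ β₂ 0 η θ₁ m₀ (t + 1)).pos ≤ f (adam f β₁ β₂ 0 η θ₁ m₀ t).pos -
          c₁ * η * (μ * f (adam f β₁ β₂ 0 η θ₁ m₀ t).pos ^ τ) +
          c₂ * η ^ 2 * (f (adam f β₁ β₂ 0 η θ₁ m₀ t).pos + H₀ / H₁) := by
  obtain ⟨η₀, c₁, c₂, hη₀, hc₁, hc₂, H⟩ :=
    exists_adam_descent (L := max K 1 ^ 2 * H₁) (by positivity) hβ₁ hβ hβ₂
  refine ⟨η₀, c₁, c₂, hη₀, hc₁, hc₂, fun η hη hηle H₀ hH₀ D hK f hf θ₁ m₀ hm₀ t => ?_⟩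
  have h1 := H η hη hηle (H₀ / H₁) (by positivity) D f
    (hf.relativelySmooth hpq hH₀ hH₁ (hK.trans (le_max_left _ _))) θ₁ m₀ hm₀ t
  set θ := (adam f β₁ β₂ 0 η θ₁ m₀ t).pos
  have h2 : μ * f θ ^ τ ≤ ∑ i, |gradient f θ i| := by
    have := (hf.lojasiewicz θ).2.trans (lpNorm_le_sum_abs q _)
    rwa [hf.inf_eq_zero, sub_zero] at this
  have h3 := mul_le_mul_of_nonneg_left h2 (mul_nonneg hc₁.le hη.le)
  linarith

/-! ### Rates of decay of real sequences -/

theorem exists_le_of_exp_decay {x : ℕ → ℝ} {ε F k : ℝ} (hε : 0 < ε) (hk : 0 < k) (hF : 1 ≤ F)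
    (h0 : x 0 ≤ F)
    (hstep : ∀ t, ε < x t → x t ≤ F → x (t + 1) ≤ Real.exp (-k) * x t) :
    ∃ T : ℕ, (T : ℝ) ≤ ((Real.log F + 1) / k + 1) * (1 + max 0 (Real.log (1 / ε))) ∧
      x T ≤ ε := by
  set l := max 0 (Real.log (1 / ε)) with hl
  have hl0 : 0 ≤ l := le_max_left _ _
  have hlF : 0 ≤ Real.log F := Real.log_nonneg hF
  have hF0 : 0 < F := by linarith
  set N := ⌈(Real.log F + l) / k⌉₊ with hN
  have hN1 : (N : ℝ) < (Real.log F + l) / k + 1 := Nat.ceil_lt_add_one (by positivity)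
  have hN2 : (Real.log F + l) / k ≤ N := Nat.le_ceil _
  have hNle : (N : ℝ) ≤ ((Real.log F + 1) / k + 1) * (1 + l) := by
    have : ((Real.log F + 1) / k + 1) * (1 + l) =
        (Real.log F + l) / k + 1 + (1 / k + l * (Real.log F / k + 1)) := by ring
    have h2 : 0 ≤ 1 / k + l * (Real.log F / k + 1) := by positivity
    linarith
  by_contra! hcon
  have hgt : ∀ t ≤ N, ε < x t := fun t ht =>
    hcon t (le_trans (by exact_mod_cast ht) hNle)
  have hexp : ∀ t ≤ N, x t ≤ Real.exp (-k * t) * F := by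
    intro t
    induction t with
    | zero => intro _; simpa using h0
    | succ t ih =>
      intro ht
      have ih' := ih (by omega)
      have h1 : Real.exp (-k * t) ≤ 1 := by
        rw [Real.exp_le_one_iff]
        have : 0 ≤ k * t := by positivity
        linarith
      have hle : x t ≤ F := ih'.trans (by nlinarith)
      calc x (t + 1) ≤ Real.exp (-k) * x t := hstep t (hgt t (by omega)) hle
        _ ≤ Real.exp (-k) * (Real.exp (-k * t) * F) := by gcongr
        _ = Real.exp (-k * (t + 1 : ℕ)) * F := by
          rw [← mul_assoc, ← Real.exp_add]
          congr 2
          push_cast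
          ring
  have h1 := (hgt N le_rfl).trans_le (hexp N le_rfl)
  have h2 : Real.log F + l ≤ k * N := by
    rwa [div_le_iff₀' hk] at hN2
  have h3 : Real.log ε < -k * N + Real.log F := by
    have := Real.log_lt_log hε h1
    rwa [Real.log_mul (Real.exp_pos _).ne' hF0.ne', Real.log_exp] at this
  have h4 : -Real.log ε ≤ l := by
    rw [hl, one_div, Real.log_inv]; exact le_max_right _ _
  linarith

/-- A step `x ↦ x - d √x` lowers `√x` by at least `d / 2`. -/
theorem exists_le_of_sqrt_decay {x : ℕ → ℝ} {ε F d : ℝ} (hε : 0 < ε) (hd : 0 < d)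
    (h0 : x 0 ≤ F) (hx : ∀ t, 0 ≤ x t)
    (hstep : ∀ t, ε < x t → x t ≤ F → x (t + 1) ≤ x t - d * √(x t)) :
    ∃ T : ℕ, (T : ℝ) ≤ 2 * √F / d + 1 ∧ x T ≤ ε := by
  set N := ⌊2 * √F / d⌋₊ + 1 with hN
  have hN1 : 2 * √F / d < N := by
    rw [hN]; push_cast; exact Nat.lt_floor_add_one _
  have hN2 : (N : ℝ) ≤ 2 * √F / d + 1 := by
    rw [hN]; push_cast; gcongr; exact Nat.floor_le (by positivity)
  by_contra! hcon
  have hgt : ∀ t ≤ N, ε < x t := fun t ht =>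
    hcon t (le_trans (by exact_mod_cast ht) hN2)
  have hsq : ∀ t ≤ N, x t ≤ F ∧ √(x t) ≤ √F - t * (d / 2) := by
    intro t
    induction t with
    | zero => intro _; exact ⟨h0, by simpa using Real.sqrt_le_sqrt h0⟩
    | succ t ih =>
      intro ht
      obtain ⟨ih1, ih2⟩ := ih (by omega)
      have h1 := hstep t (hgt t (by omega)) ih1
      have hs : 0 < √(x t) := Real.sqrt_pos.2 (hε.trans (hgt t (by omega)))
      have hss : √(x t) ^ 2 = x t := Real.sq_sqrt (hx t)
      have hds : d ≤ √(x t) := by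
        have h2 : d * √(x t) ≤ √(x t) * √(x t) := by nlinarith [hx (t + 1)]
        exact le_of_mul_le_mul_right h2 hs
      refine ⟨by nlinarith, ?_⟩
      have h2 : √(x (t + 1)) ≤ √(x t) - d / 2 := by
        rw [Real.sqrt_le_left (by linarith)]
        nlinarith [sq_nonneg d]
      push_cast
      linarith
  have h1 := (hsq N le_rfl).2
  rw [div_lt_iff₀ hd] at hN1
  have := Real.sqrt_nonneg (x N)
  linarith

theorem mul_rpow_le_rpow {y F τ : ℝ} (hτ₁ : τ ≤ 1) (hy : 0 < y) (hyF : y ≤ F) :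
    F ^ (τ - 1) * y ≤ y ^ τ := by
  have h1 : y ^ τ = y ^ (τ - 1) * y := by
    rw [Real.rpow_sub_one hy.ne', div_mul_cancel₀ _ hy.ne']
  rw [h1]
  exact mul_le_mul_of_nonneg_right (Real.rpow_le_rpow_of_nonpos hy hyF (by linarith)) hy.le

theorem rpow_eq_rpow_sub_half_mul_sqrt {y τ : ℝ} (hy : 0 < y) :
    y ^ τ = y ^ (τ - 1 / 2) * √y := by
  rw [Real.sqrt_eq_rpow, ← Real.rpow_add hy]
  congr 1
  ring

/-! ### Convergence of Adam -/

theorem mainTheorem3 (p q : ENNReal) [Fact (1 ≤ p)] [Fact (1 ≤ q)] (hpq : p⁻¹ + q⁻¹ = 1)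
    (H₁ τ μ β₁ β₂ F K : ℝ) (hH₁ : 0 < H₁) (hτ₀ : 0 < τ) (hτ₁ : τ ≤ 1) (hμ : 0 < μ)
    (hβ₁ : 0 ≤ β₁) (hβ : β₁ ≤ β₂) (hβ₂ : β₂ < 1) :
    -- Accuracy above `H₀ / H₁`: constant step-size, linear convergence.
    (∃ ηbar : ℝ, 0 < ηbar ∧ ∀ η : ℝ, 0 < η → η ≤ ηbar → ∃ C : ℝ,
      ∀ (H₀ : ℝ), 0 ≤ H₀ → ∀ (D : ℕ), (D : ℝ) ^ (p⁻¹).toReal ≤ K →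
      ∀ f : EuclideanSpace ℝ (Fin D) → ℝ, ObjectiveAssumptions p q H₀ H₁ τ μ f →
      ∀ θ₁ m₀ : EuclideanSpace ℝ (Fin D), f θ₁ ≤ F → (m₀ = gradient f θ₁ ∨ m₀ = 0) →
      ∀ ε : ℝ, H₀ / H₁ < ε →
        ∃ T : ℕ, (T : ℝ) ≤ C * (1 + max 0 (Real.log (1 / ε))) ∧
          f (adam f β₁ β₂ 0 η θ₁ m₀ T).pos ≤ ε) ∧
    -- Accuracy at most `H₀ / H₁`: step-size proportional to `ε ^ (2 τ)`, sublinear convergence.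
    (∀ (H₀ : ℝ), 0 ≤ H₀ →
      ∃ cbar : ℝ, 0 < cbar ∧ ∀ c : ℝ, 0 < c → c ≤ cbar → ∃ C : ℝ,
      ∀ (D : ℕ), (D : ℝ) ^ (p⁻¹).toReal ≤ K →
      ∀ f : EuclideanSpace ℝ (Fin D) → ℝ, ObjectiveAssumptions p q H₀ H₁ τ μ f →
      ∀ θ₁ m₀ : EuclideanSpace ℝ (Fin D), f θ₁ ≤ F → (m₀ = gradient f θ₁ ∨ m₀ = 0) →
      ∀ ε : ℝ, 0 < ε → ε ≤ H₀ / H₁ →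
        ∃ T : ℕ, (τ ≤ 1 / 2 → (T : ℝ) ≤ C / ε ^ (2 * τ)) ∧
          (1 / 2 < τ → (T : ℝ) ≤ C / ε ^ (4 * τ - 1)) ∧
          f (adam f β₁ β₂ 0 (c * ε ^ (2 * τ)) θ₁ m₀ T).pos ≤ ε) := by
  obtain ⟨η₀, c₁, c₂, hη₀, hc₁, hc₂, hdesc⟩ :=
    exists_adam_descent_of_objectiveAssumptions p q hpq (τ := τ) (μ := μ) K hH₁ hβ₁ hβ hβ₂
  set G := max F 1 with hG
  have hG1 : 1 ≤ G := le_max_right _ _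
  have hG0 : 0 < G := by linarith
  refine ⟨?_, fun H₀ hH₀ => ?_⟩
  · set w := c₁ * μ * G ^ (τ - 1) with hw
    have hw0 : 0 < w := by positivity
    refine ⟨min η₀ (w / (4 * c₂)), by positivity, fun η hη hηle =>
      ⟨(Real.log G + 1) / (w / 2 * η) + 1, ?_⟩⟩
    intro H₀ hH₀ D hK f hf θ₁ m₀ hF hm₀ ε hε
    have hh : 0 ≤ H₀ / H₁ := by positivity
    refine exists_le_of_exp_decay (x := fun t => f (adam f β₁ β₂ 0 η θ₁ m₀ t).pos)
      (hh.trans_lt hε) (by positivity) hG1 (hF.trans (le_max_left _ _)) fun t ht htG => ?_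
    have h1 := hdesc η hη (hηle.trans (min_le_left _ _)) H₀ hH₀ D hK f hf θ₁ m₀ hm₀ t
    beta_reduce at ht htG ⊢
    set y := f (adam f β₁ β₂ 0 η θ₁ m₀ t).pos
    have hy : 0 < y := by linarith
    have h2 : c₁ * η * (μ * (G ^ (τ - 1) * y)) ≤ c₁ * η * (μ * y ^ τ) := by
      gcongr
      exact mul_rpow_le_rpow hτ₁ hy htG
    have h3 : c₂ * η ^ 2 * (y + H₀ / H₁) ≤ c₂ * η ^ 2 * (2 * y) := by
      gcongr
      linarith
    have h4 : 4 * c₂ * η ≤ w := by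
      have := hηle.trans (min_le_right _ _)
      rwa [le_div_iff₀' (by positivity)] at this
    have h5 : 4 * c₂ * η * (η * y) ≤ w * (η * y) :=
      mul_le_mul_of_nonneg_right h4 (by positivity)
    have h6 : (1 - w / 2 * η) * y ≤ Real.exp (-(w / 2 * η)) * y := by
      gcongr
      linarith [Real.add_one_le_exp (-(w / 2 * η))]
    have h7 : c₁ * η * (μ * (G ^ (τ - 1) * y)) = w * (η * y) := by rw [hw]; ring
    linarith
  · -- `E` bounds `ε` and stays positive when `H₀ = 0`.
    set E := H₀ / H₁ + 1 with hE
    have hE0 : 0 < E := by positivity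
    refine ⟨min (η₀ / E ^ (2 * τ)) (c₁ * μ / (2 * c₂ * (G + E) * E ^ τ)), by positivity,
      fun c hc hcle => ?_⟩
    set Q := 4 * √G / (c₁ * μ * c) with hQ
    -- The iteration count in terms of a lower bound `w √y` for `y ^ τ` on `(ε, G]`.
    have key : ∀ (D : ℕ), (D : ℝ) ^ (p⁻¹).toReal ≤ K →
        ∀ f : EuclideanSpace ℝ (Fin D) → ℝ, ObjectiveAssumptions p q H₀ H₁ τ μ f →
        ∀ θ₁ m₀ : EuclideanSpace ℝ (Fin D), f θ₁ ≤ F → (m₀ = gradient f θ₁ ∨ m₀ = 0) →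
        ∀ ε : ℝ, 0 < ε → ε ≤ H₀ / H₁ → ∀ w : ℝ, 0 < w →
        (∀ y, ε < y → y ≤ G → w * √y ≤ y ^ τ) →
        ∃ T : ℕ, (T : ℝ) ≤ Q / (ε ^ (2 * τ) * w) + 1 ∧
          f (adam f β₁ β₂ 0 (c * ε ^ (2 * τ)) θ₁ m₀ T).pos ≤ ε := by
      intro D hK f hf θ₁ m₀ hF hm₀ ε hε hεle w hw hwy
      have hεE : ε ≤ E := by linarith
      set η := c * ε ^ (2 * τ) with hη
      have hη0 : 0 < η := by positivity
      have hηle : η ≤ η₀ := by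
        have h1 := hcle.trans (min_le_left _ _)
        rw [le_div_iff₀ (by positivity)] at h1
        refine le_trans ?_ h1
        rw [hη]
        gcongr
      have h2 : c₂ * η * (G + E) ≤ c₁ * μ / 2 * ε ^ τ := by
        have h1 := hcle.trans (min_le_right _ _)
        rw [le_div_iff₀ (by positivity)] at h1
        have h3 : ε ^ (2 * τ) = ε ^ τ * ε ^ τ := by rw [two_mul, Real.rpow_add hε]
        have h4 : ε ^ τ ≤ E ^ τ := by gcongr
        calc c₂ * η * (G + E) = c₂ * c * (G + E) * ε ^ τ * ε ^ τ := by rw [hη, h3]; ring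
          _ ≤ c₂ * c * (G + E) * E ^ τ * ε ^ τ := by gcongr
          _ ≤ c₁ * μ / 2 * ε ^ τ := by gcongr; linarith
      have hd : 0 < c₁ * μ / 2 * η * w := by positivity
      obtain ⟨T, hT, hTε⟩ := exists_le_of_sqrt_decay
        (x := fun t => f (adam f β₁ β₂ 0 η θ₁ m₀ t).pos) (F := G) hε hd
        (hF.trans (le_max_left _ _)) (fun t => hf.nonneg _) (fun t ht htG => by
          have h1 := hdesc η hη0 hηle H₀ hH₀ D hK f hf θ₁ m₀ hm₀ t
          set y := f (adam f β₁ β₂ 0 η θ₁ m₀ t).pos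
          have h3 : c₂ * η ^ 2 * (y + H₀ / H₁) ≤ η * (c₁ * μ / 2 * y ^ τ) := by
            calc c₂ * η ^ 2 * (y + H₀ / H₁) ≤ c₂ * η ^ 2 * (G + E) := by
                  gcongr; linarith
              _ = η * (c₂ * η * (G + E)) := by ring
              _ ≤ η * (c₁ * μ / 2 * ε ^ τ) := by gcongr
              _ ≤ η * (c₁ * μ / 2 * y ^ τ) := by gcongr
          have h4 : c₁ * μ / 2 * η * (w * √y) ≤ c₁ * μ / 2 * η * y ^ τ := by
            gcongr
            exact hwy y ht htG
          linarith)
      refine ⟨T, hT.trans (le_of_eq ?_), hTε⟩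
      rw [hQ, hη]
      field_simp
      ring
    rcases le_or_gt τ (1 / 2) with hτ | hτ
    · refine ⟨Q / G ^ (τ - 1 / 2) + E ^ (2 * τ), ?_⟩
      intro D hK f hf θ₁ m₀ hF hm₀ ε hε hεle
      obtain ⟨T, hT, hTε⟩ := key D hK f hf θ₁ m₀ hF hm₀ ε hε hεle (G ^ (τ - 1 / 2))
        (by positivity) fun y hy hyG => by
          rw [rpow_eq_rpow_sub_half_mul_sqrt (hε.trans hy)]
          exact mul_le_mul_of_nonneg_right
            (Real.rpow_le_rpow_of_nonpos (hε.trans hy) hyG (by linarith)) (Real.sqrt_nonneg y)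
      refine ⟨T, fun _ => hT.trans ?_, fun h => absurd h (not_lt.2 hτ), hTε⟩
      have h1 : ε ^ (2 * τ) ≤ E ^ (2 * τ) := by gcongr; linarith
      rw [add_div, mul_comm (ε ^ _), ← div_div]
      gcongr
      rwa [one_le_div (by positivity)]
    · have hτ' : 0 ≤ τ - 1 / 2 := by linarith
      refine ⟨Q * E ^ (τ - 1 / 2) + E ^ (4 * τ - 1), ?_⟩
      intro D hK f hf θ₁ m₀ hF hm₀ ε hε hεle
      have hεE : ε ≤ E := by linarith
      obtain ⟨T, hT, hTε⟩ := key D hK f hf θ₁ m₀ hF hm₀ ε hε hεle (ε ^ (τ - 1 / 2))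
        (by positivity) fun y hy hyG => by
          rw [rpow_eq_rpow_sub_half_mul_sqrt (hε.trans hy)]
          gcongr
      refine ⟨T, fun h => absurd h (not_le.2 hτ), fun _ => hT.trans ?_, hTε⟩
      have h1 : ε ^ (4 * τ - 1) ≤ E ^ (4 * τ - 1) := by gcongr; linarith
      have h2 : ε ^ (τ - 1 / 2) ≤ E ^ (τ - 1 / 2) := by gcongr
      -- The exponent `2 τ + (τ - 1 / 2)` falls short of `4 τ - 1` by `τ - 1 / 2 ≥ 0`.
      have h3 : Q / (ε ^ (2 * τ) * ε ^ (τ - 1 / 2)) =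
          Q * ε ^ (τ - 1 / 2) / ε ^ (4 * τ - 1) := by
        have h4 : ε ^ (4 * τ - 1) = ε ^ (2 * τ) * ε ^ (τ - 1 / 2) * ε ^ (τ - 1 / 2) := by
          rw [← Real.rpow_add hε, ← Real.rpow_add hε]
          congr 1
          ring
        rw [h4, mul_div_mul_right _ _ (by positivity)]
      rw [h3, add_div]
      gcongr
      rwa [one_le_div (by positivity)]
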